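/- Let $S^2$ be the unit sphere in $\mathbb{R}^3$ and let $G$ be a finite group acting freely by homeomorphisms on $S^2$. For $n\ge 0$ let $$C_n^G(S^2)=\{(p_1,\dots,p_n)\in (S^2)^n : p_i\notin G\cdot p_j \text{ for all } i\neq j\},$$ with the subspace topology of $(S^2)^n$ (so $C_0^G(S^2)$ is a point), and let $\pi^n: C_{n+1}^G(S^2)\to C_n^G(S^2)$ be the projection $(p_1,\dots,p_{n+1})\mapsto(p_1,\dots,p_n)$. A cross-section of $\pi^n$ is a continuous map $s: C_n^G(S^2)\to C_{n+1}^G(S^2)$ with $\pi^n\circ s=\mathrm{id}$. 1. If $G=\{1\}$, then for every $n\ge 0$, $\pi^n$ admits a cross-section if and only if $n\neq 2$. 2. If $G\neq\{1\}$, then for every $n\ge 1$, $\pi^n$ admits a cross-section if and only if $n\geq 2$. -/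

import Mathlib

/-- The `n`-point orbit configuration space of an action of `G` on `X`, with the subspace topology
of `Xⁿ`: tuples `(p₁, …, pₙ)` with `pᵢ ∉ G • pⱼ` for `i ≠ j`. -/
def orbitConf (G : Type*) [Group G] (X : Type*) [MulAction G X] (n : ℕ) : Set (Fin n → X) :=
  {p | ∀ i j : Fin n, i ≠ j → p i ∉ MulAction.orbit G (p j)}

/-- The projection from `(n + 1)`-point configurations to `n`-point configurations that keeps the
first `n` coordinates. -/
def orbitConfProj (G : Type*) [Group G] (X : Type*) [MulAction G X] [TopologicalSpace X] (n : ℕ) :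
    C(orbitConf G X (n + 1), orbitConf G X n) where
  toFun p := ⟨fun i => p.1 i.castSucc,
    fun i j hij => p.2 i.castSucc j.castSucc ((Fin.castSucc_injective n).ne hij)⟩
  continuous_toFun := Continuous.subtype_mk
    (continuous_pi fun i => (continuous_apply i.castSucc).comp continuous_subtype_val) _

/-- A continuous map admits a cross-section if it has a continuous right inverse. -/
def AdmitsCrossSection {E B : Type*} [TopologicalSpace E] [TopologicalSpace B] (π : C(E, B)) :
    Prop :=
  ∃ s : C(B, E), π.comp s = ContinuousMap.id B

/-- The two-sphere, as the unit sphere of Euclidean three-space. -/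
abbrev TwoSphere : Type := Metric.sphere (0 : EuclideanSpace ℝ (Fin 3)) 1

/-! A cross-section is a continuous choice of a point `q p` off the orbits of the configuration `p`.
Inversion centred at `x` sends the rest of the sphere to a plane parallel to the tangent plane at
`x`, so two points distinct from each other and from `x` give a nonzero tangent vector there, the
difference of their images.

Obstruction: along `x ↦ (x, -x)` for trivial `G`, or `x ↦ x` for `n = 1` and `g ≠ 1`, the point `q`
together with `-x` or `g • x` would give a nowhere zero tangent field, against the hairy ball
theorem.

Existence: three distinct moving points (`p 0`, `p 1`, and `p 2` or `g • p 0`) give a direction at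
`p 0`; going far enough in the inverted plane and inverting back yields a point near `p 0` that
misses all the orbits. The cases `n = 0, 1` with trivial `G` use a constant and the antipode. -/

open scoped ComplexConjugate

/-! ### Hairy ball theorem -/

/-- The square map, up to sign, of the unit circle does not extend to a nowhere vanishing continuous
function on the plane. -/
theorem exists_ne_neg_sq_of_continuous_ne_zero {F : ℂ → ℂ} (hF : Continuous F)
    (h0 : ∀ a, F a ≠ 0) : ∃ a : ℂ, ‖a‖ = 1 ∧ F a ≠ -a ^ 2 := by
  by_contra! h
  obtain ⟨k, ⟨-, hk⟩, -⟩ := Complex.isCoveringMapOn_exp.existsUnique_continuousMap_lifts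
    ⟨F, hF⟩ (a₀ := (0 : ℂ)) (Complex.exp_log (h0 0)) (fun a => h0 a)
  have hk' : ∀ a, Complex.exp (k a) = F a := fun a => congrFun hk a
  have hexp : ∀ θ : ℝ, Complex.exp (k (Complex.exp (θ * Complex.I)))
      = Complex.exp (2 * (θ * Complex.I) + k 1) := by
    intro θ
    rw [Complex.exp_add, hk', hk', h _ (Complex.norm_exp_ofReal_mul_I θ), h 1 (by simp),
      two_mul, Complex.exp_add]
    ring
  -- Two lifts of one loop through `exp` that agree at `θ = 0`; at `θ = 2π` they differ by `4πi`.
  have heq := Complex.isCoveringMap_exp.eq_of_comp_eq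
    (g₁ := fun θ : ℝ => k (Complex.exp (θ * Complex.I)))
    (g₂ := fun θ : ℝ => 2 * (θ * Complex.I) + k 1)
    (by fun_prop) (by fun_prop) (funext fun θ => Subtype.ext (hexp θ)) 0 (by simp)
  have h2 := congrFun heq (2 * Real.pi)
  simp [Complex.exp_two_pi_mul_I, Real.pi_ne_zero] at h2

/-- Inverse stereographic projection to the unit sphere, from the pole `(0, 0, -ε)` when
`ε = ±1`. -/
noncomputable def planeToSphere (ε : ℝ) (hε : ε ^ 2 = 1) (a : ℂ) : TwoSphere :=
  ⟨!₂[2 * a.re / (1 + (a.re ^ 2 + a.im ^ 2)), 2 * a.im / (1 + (a.re ^ 2 + a.im ^ 2)),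
    ε * ((1 - (a.re ^ 2 + a.im ^ 2)) / (1 + (a.re ^ 2 + a.im ^ 2)))], by
    have h : (1 + (a.re ^ 2 + a.im ^ 2)) ≠ 0 := by positivity
    rw [mem_sphere_zero_iff_norm, ← sq_eq_sq₀ (norm_nonneg _) zero_le_one,
      EuclideanSpace.real_norm_sq_eq]
    simp only [Fin.sum_univ_three]
    simp
    rw [mul_pow ε, hε]
    field_simp
    ring⟩

theorem continuous_planeToSphere (ε : ℝ) (hε : ε ^ 2 = 1) : Continuous (planeToSphere ε hε) := by
  refine Continuous.subtype_mk ((PiLp.continuous_toLp 2 _).comp (continuous_pi fun i => ?_)) _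
  have h : ∀ a : ℂ, (1 + (a.re ^ 2 + a.im ^ 2)) ≠ 0 := fun a => by positivity
  fin_cases i <;> simp <;> fun_prop (disch := exact h _)

/-- The differential of the stereographic projection from the pole `(0, 0, ε)`, up to a positive
factor: the image of the tangent vector `v` at the point `x`. -/
noncomputable def poleChartVector (ε : ℝ) (x v : EuclideanSpace ℝ (Fin 3)) : ℂ :=
  ⟨v 0 * (1 - ε * x 2) + ε * x 0 * v 2, v 1 * (1 - ε * x 2) + ε * x 1 * v 2⟩

/-- Away from the pole, the differential of the chart is injective on tangent vectors. -/
theorem poleChartVector_ne_zero {ε : ℝ} (hε : ε ^ 2 = 1) {x v : EuclideanSpace ℝ (Fin 3)}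
    (hx : ‖x‖ = 1) (hxε : 1 - ε * x 2 ≠ 0) (hxv : inner ℝ x v = 0) (hv : v ≠ 0) :
    poleChartVector ε x v ≠ 0 := by
  intro h
  have hre : v 0 * (1 - ε * x 2) + ε * x 0 * v 2 = 0 := congrArg Complex.re h
  have him : v 1 * (1 - ε * x 2) + ε * x 1 * v 2 = 0 := congrArg Complex.im h
  have hn : x 0 ^ 2 + x 1 ^ 2 + x 2 ^ 2 = 1 := by
    have := EuclideanSpace.real_norm_sq_eq x
    rw [hx, Fin.sum_univ_three] at this
    linarith
  have hi : x 0 * v 0 + x 1 * v 1 + x 2 * v 2 = 0 := by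
    rw [PiLp.inner_apply, Fin.sum_univ_three] at hxv
    simp at hxv
    linarith
  have h2 : v 2 = 0 := by
    have : (1 - ε * x 2) * (ε * v 2) = 0 := by
      linear_combination x 0 * hre + x 1 * him - (1 - ε * x 2) * hi - ε * v 2 * hn
        - x 2 * v 2 * hε
    have hε0 : ε ≠ 0 := by rintro rfl; norm_num at hε
    simpa [hxε, hε0] using this
  have h0 : v 0 = 0 := by simpa [h2, hxε] using hre
  have h1 : v 1 = 0 := by simpa [h2, hxε] using him
  apply hv
  ext i
  fin_cases i <;> simpa

theorem Continuous.poleChartVector {Y : Type*} [TopologicalSpace Y] (ε : ℝ)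
    {x v : Y → EuclideanSpace ℝ (Fin 3)} (hx : Continuous x) (hv : Continuous v) :
    Continuous fun y => poleChartVector ε (x y) (v y) := by
  have h : ∀ i, Continuous fun y => x y i := fun i => by fun_prop
  have h' : ∀ i, Continuous fun y => v y i := fun i => by fun_prop
  have := h 0
  have := h 1
  have := h 2
  have := h' 0
  have := h' 1
  have := h' 2
  refine Complex.equivRealProdCLM.symm.continuous.comp (Continuous.prodMk ?_ ?_) <;> fun_prop

theorem one_add_mul_planeToSphere_ne_zero (ε : ℝ) (hε : ε ^ 2 = 1) (a : ℂ) :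
    1 + ε * (planeToSphere ε hε a).1 2 ≠ 0 := by
  have h : (1 + (a.re ^ 2 + a.im ^ 2)) ≠ 0 := by positivity
  have : 1 + ε * (planeToSphere ε hε a).1 2 = 2 / (1 + (a.re ^ 2 + a.im ^ 2)) := by
    simp only [planeToSphere]
    simp
    rw [← mul_assoc, ← sq, hε]
    field_simp
    ring
  rw [this]
  positivity

/-- The hairy ball theorem: a continuous tangent vector field on the two-sphere has a zero. -/
theorem exists_eq_zero_of_continuous_tangent {v : TwoSphere → EuclideanSpace ℝ (Fin 3)}
    (hv : Continuous v) (htan : ∀ x : TwoSphere, inner ℝ x.1 (v x) = 0) : ∃ x, v x = 0 := by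
  by_contra! h
  set φ := planeToSphere 1 (by norm_num) with hφ
  set ψ := planeToSphere (-1) (by norm_num) with hψ
  have hφc : Continuous φ := continuous_planeToSphere _ _
  have hψc : Continuous ψ := continuous_planeToSphere _ _
  set w : ℂ → ℂ := fun a => poleChartVector 1 (ψ a).1 (v (ψ a)) with hw
  set w' : ℂ → ℂ := fun a => poleChartVector (-1) (φ a).1 (v (φ a)) with hw'
  have hwc : Continuous w :=
    Continuous.poleChartVector _ (continuous_subtype_val.comp hψc) (hv.comp hψc)
  have hwc' : Continuous w' :=
    Continuous.poleChartVector _ (continuous_subtype_val.comp hφc) (hv.comp hφc)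
  have hw0 : ∀ a, w a ≠ 0 := fun a => by
    refine poleChartVector_ne_zero (by norm_num) (mem_sphere_zero_iff_norm.1 (ψ a).2) ?_
      (htan _) (h _)
    simpa [sub_eq_add_neg] using one_add_mul_planeToSphere_ne_zero (-1) (by norm_num) a
  have hw0' : ∀ a, conj (w' a) ≠ 0 := fun a => by
    refine (map_ne_zero _).2 <| poleChartVector_ne_zero (by norm_num)
      (mem_sphere_zero_iff_norm.1 (φ a).2) ?_ (htan _) (h _)
    simpa [sub_eq_add_neg] using one_add_mul_planeToSphere_ne_zero 1 (by norm_num) a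
  obtain ⟨a, ha, hne⟩ := exists_ne_neg_sq_of_continuous_ne_zero
    (F := fun a => w a / conj (w' a)) (hwc.div (by fun_prop) hw0')
    (fun a => div_ne_zero (hw0 a) (hw0' a))
  have ha' : a.re ^ 2 + a.im ^ 2 = 1 := by
    have := Complex.sq_norm a
    rw [ha, Complex.normSq_apply] at this
    linarith
  have hψφ : ψ a = φ a := by
    simp [hψ, hφ, planeToSphere, ha']
  have hval : (φ a).1 = !₂[a.re, a.im, 0] := by
    simp [hφ, planeToSphere, ha']
    norm_num
  -- At `|a| = 1` the chart transition `a ↦ a / |a|²` has as differential the reflection `u ↦ -a²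
  -- conj u`, which carries `w' a` to `w a`.
  apply hne
  rw [div_eq_iff (hw0' a)]
  have hi : a.re * v (φ a) 0 + a.im * v (φ a) 1 = 0 := by
    have := htan (φ a)
    rw [hval, PiLp.inner_apply, Fin.sum_univ_three] at this
    simp at this
    linarith
  simp only [hw, hw', hψφ, hval]
  generalize v (φ a) = u at hi
  apply Complex.ext
  · simp [poleChartVector, sq]
    linear_combination 2 * a.re * hi - (u 0 + a.re * u 2) * ha'
  · simp [poleChartVector, sq]
    linear_combination 2 * a.im * hi - (u 1 + a.im * u 2) * ha'

/-! ### Inversion centred at a point of the sphere -/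

section Inversion

variable {E : Type*} [NormedAddCommGroup E] [InnerProductSpace ℝ E]

/-- The inversion of `y` in the unit sphere centred at `x`, relative to `x`. For unit vectors `x`
and `y` it lies in the plane of vectors with inner product `-1 / 2` with `x`. -/
noncomputable def relInversion (x y : E) : E := (‖y - x‖ ^ 2)⁻¹ • (y - x)

/-- Inversion replaces the distance to `x` by its reciprocal, so the image determines the scaling
factor, hence the point. -/
theorem relInversion_ne {x y z : E} (hyx : y ≠ x) (hyz : y ≠ z) :
    relInversion x y ≠ relInversion x z := by
  intro h
  have hy : ‖y - x‖ ≠ 0 := norm_ne_zero_iff.2 (sub_ne_zero.2 hyx)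
  have hn : ∀ u : E, ‖relInversion x u‖ = ‖u - x‖⁻¹ := fun u => by
    rw [relInversion, norm_smul, norm_inv, norm_pow, norm_norm]
    rcases eq_or_ne ‖u - x‖ 0 with h0 | h0
    · simp [h0]
    · field_simp
  have hyz' : ‖y - x‖ = ‖z - x‖ := inv_injective (by rw [← hn, ← hn, h])
  rw [relInversion, relInversion, ← hyz'] at h
  exact hyz (sub_left_injective (smul_right_injective E (inv_ne_zero (pow_ne_zero 2 hy)) h))

theorem inner_relInversion {x y : E} (hx : ‖x‖ = 1) (hy : ‖y‖ = 1) (hyx : y ≠ x) :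
    inner ℝ x (relInversion x y) = -1 / 2 := by
  have h0 : ‖y - x‖ ^ 2 ≠ 0 := pow_ne_zero 2 (norm_ne_zero_iff.2 (sub_ne_zero.2 hyx))
  have h1 : inner ℝ x (y - x) = -1 / 2 * ‖y - x‖ ^ 2 := by
    rw [norm_sub_sq_real, inner_sub_right, real_inner_self_eq_norm_sq, hx, hy, real_inner_comm]
    ring
  rw [relInversion, inner_smul_right, h1, mul_comm, mul_assoc, mul_inv_cancel₀ h0, mul_one]

theorem inner_relInversion_sub {x y z : E} (hx : ‖x‖ = 1) (hy : ‖y‖ = 1) (hz : ‖z‖ = 1)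
    (hyx : y ≠ x) (hzx : z ≠ x) :
    inner ℝ x (relInversion x y - relInversion x z) = 0 := by
  rw [inner_sub_right, inner_relInversion hx hy hyx, inner_relInversion hx hz hzx, sub_self]

/-- Converse to `inner_relInversion`: inverting back from the plane lands on the sphere. -/
theorem norm_add_inv_smul {x m : E} (hx : ‖x‖ = 1) (hm : m ≠ 0) (hxm : inner ℝ x m = -1 / 2) :
    ‖x + (‖m‖ ^ 2)⁻¹ • m‖ = 1 := by
  have h0 : ‖m‖ ≠ 0 := norm_ne_zero_iff.2 hm
  rw [← sq_eq_sq₀ (norm_nonneg _) zero_le_one, norm_add_sq_real, inner_smul_right, hxm, hx,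
    norm_smul, norm_inv, norm_pow, norm_norm]
  field_simp
  ring

theorem continuous_relInversion {Y : Type*} [TopologicalSpace Y] {x y : Y → E}
    (hx : Continuous x) (hy : Continuous y) (h : ∀ t, y t ≠ x t) :
    Continuous fun t => relInversion (x t) (y t) := by
  unfold relInversion
  exact (((hy.sub hx).norm.pow 2).inv₀ fun t =>
    pow_ne_zero 2 (norm_ne_zero_iff.2 (sub_ne_zero.2 (h t)))).smul (hy.sub hx)

end Inversion

theorem TwoSphere.norm_coe (x : TwoSphere) : ‖(x : EuclideanSpace ℝ (Fin 3))‖ = 1 :=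
  mem_sphere_zero_iff_norm.1 x.2

/-- No two continuous self-maps of the two-sphere are pairwise coincidence free together with the
identity. -/
theorem TwoSphere.exists_coincidence {f g : TwoSphere → TwoSphere} (hf : Continuous f)
    (hg : Continuous g) : ∃ x, f x = x ∨ g x = x ∨ f x = g x := by
  by_contra! h
  have hfx : ∀ x, (f x).1 ≠ x.1 := fun x => Subtype.coe_ne_coe.2 (h x).1
  have hgx : ∀ x, (g x).1 ≠ x.1 := fun x => Subtype.coe_ne_coe.2 (h x).2.1
  obtain ⟨x, hx⟩ := exists_eq_zero_of_continuous_tangent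
    (v := fun x => relInversion x.1 (f x).1 - relInversion x.1 (g x).1)
    ((continuous_relInversion continuous_subtype_val (continuous_subtype_val.comp hf) hfx).sub
      (continuous_relInversion continuous_subtype_val (continuous_subtype_val.comp hg) hgx))
    (fun x => inner_relInversion_sub (norm_coe x) (norm_coe _) (norm_coe _) (hfx x) (hgx x))
  exact relInversion_ne (hfx x) (Subtype.coe_ne_coe.2 (h x).2.2) (sub_eq_zero.1 hx)

/-- Given three pairwise distinct points of the two-sphere varying continuously, a further point can
be chosen continuously near the first one so as to avoid it and finitely many others. -/
theorem TwoSphere.exists_continuous_avoiding {Y ι : Type*} [TopologicalSpace Y] [Finite ι]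
    {a b c : Y → TwoSphere} (ha : Continuous a) (hb : Continuous b) (hc : Continuous c)
    (hba : ∀ t, b t ≠ a t) (hca : ∀ t, c t ≠ a t) (hbc : ∀ t, b t ≠ c t)
    {F : ι → Y → TwoSphere} (hF : ∀ i, Continuous (F i)) (hFa : ∀ i t, F i t ≠ a t) :
    ∃ q : Y → TwoSphere, Continuous q ∧ (∀ t, q t ≠ a t) ∧ ∀ i t, q t ≠ F i t := by
  cases nonempty_fintype ι
  have hba' : ∀ t, (b t).1 ≠ (a t).1 := fun t => Subtype.coe_ne_coe.2 (hba t)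
  have hca' : ∀ t, (c t).1 ≠ (a t).1 := fun t => Subtype.coe_ne_coe.2 (hca t)
  have hac := continuous_subtype_val.comp ha
  set v : Y → EuclideanSpace ℝ (Fin 3) := fun t =>
    relInversion (a t).1 (b t).1 - relInversion (a t).1 (c t).1
  have hvc : Continuous v :=
    (continuous_relInversion hac (continuous_subtype_val.comp hb) hba').sub
      (continuous_relInversion hac (continuous_subtype_val.comp hc) hca')
  have hv0 : ∀ t, ‖v t‖ ≠ 0 := fun t => norm_ne_zero_iff.2 <| sub_ne_zero.2 <|
    relInversion_ne (hba' t) (Subtype.coe_ne_coe.2 (hbc t))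
  have htan : ∀ t, inner ℝ (a t).1 (v t) = 0 := fun t =>
    inner_relInversion_sub (norm_coe _) (norm_coe _) (norm_coe _) (hba' t) (hca' t)
  -- The inverted image of `F i t` has norm `(dist (F i t) (a t))⁻¹`, so `r` bounds all these norms;
  -- the `1` keeps it positive when `ι` is empty.
  set r : Y → ℝ := fun t => 1 + ∑ i, (dist (F i t) (a t))⁻¹ with hr
  have hrc : Continuous r := continuous_const.add <| continuous_finsetSum _ fun i _ =>
    ((hF i).dist ha).inv₀ fun t => dist_ne_zero.2 (hFa i t)
  have hr0 : ∀ t, 0 < r t := fun t => by positivity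
  -- `-a / 2` is the foot of the perpendicular from the centre `a` to the inverted plane, read
  -- relative to the centre.
  set m : Y → EuclideanSpace ℝ (Fin 3) := fun t =>
    (-1 / 2 : ℝ) • (a t).1 + (r t / ‖v t‖) • v t with hm
  have hmc : Continuous m := (hac.const_smul (-1 / 2 : ℝ)).add ((hrc.div hvc.norm hv0).smul hvc)
  have hma : ∀ t, inner ℝ (a t).1 (m t) = -1 / 2 := fun t => by
    simp only [hm, inner_add_right, inner_smul_right, htan, real_inner_self_eq_norm_sq, norm_coe]
    norm_num
  have hrm : ∀ t, r t < ‖m t‖ := fun t => by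
    have : ‖m t‖ ^ 2 = 1 / 4 + r t ^ 2 := by
      have hv' := hv0 t
      simp only [hm]
      rw [norm_add_sq_real, inner_smul_left, inner_smul_right, htan, norm_smul, norm_smul,
        norm_coe, norm_div (r t), norm_norm, Real.norm_of_nonneg (hr0 t).le]
      field_simp
      norm_num
      ring
    exact lt_of_pow_lt_pow_left₀ 2 (norm_nonneg _) (by linarith)
  have hm0 : ∀ t, m t ≠ 0 := fun t => norm_pos_iff.1 ((hr0 t).trans (hrm t))
  have hdist : ∀ t, ‖(‖m t‖ ^ 2)⁻¹ • m t‖ = ‖m t‖⁻¹ := fun t => by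
    have := norm_ne_zero_iff.2 (hm0 t)
    rw [norm_smul, norm_inv, norm_pow, norm_norm]
    field_simp
  refine ⟨fun t => ⟨(a t).1 + (‖m t‖ ^ 2)⁻¹ • m t, mem_sphere_zero_iff_norm.2
    (norm_add_inv_smul (norm_coe _) (hm0 t) (hma t))⟩, ?_, fun t h => ?_, fun i t h => ?_⟩
  · exact (hac.add (((hmc.norm.pow 2).inv₀ fun t =>
      pow_ne_zero 2 (norm_ne_zero_iff.2 (hm0 t))).smul hmc)).subtype_mk _
  · have := congrArg Subtype.val h
    simp [hm0 t] at this
  · have hd : dist (F i t) (a t) = ‖m t‖⁻¹ := by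
      rw [← h, Subtype.dist_eq, dist_eq_norm]
      simp [← hdist t]
    have h1 : (dist (F i t) (a t))⁻¹ ≤ ∑ i, (dist (F i t) (a t))⁻¹ :=
      Finset.single_le_sum (f := fun i => (dist (F i t) (a t))⁻¹)
        (fun _ _ => by positivity) (Finset.mem_univ i)
    rw [hd, inv_inv] at h1
    have := hrm t
    simp only [hr] at this
    linarith

/-! ### Cross-sections as continuous choices of a point -/

section OrbitConf

variable {G X : Type*} [Group G] [MulAction G X]

theorem orbitConf.apply_ne {n : ℕ} (p : orbitConf G X n) {i j : Fin n}
    (hij : i ≠ j) : p.1 i ≠ p.1 j :=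
  fun h => p.2 i j hij (h ▸ MulAction.mem_orbit_self _)

variable [TopologicalSpace X]

/-- A cross-section of the projection of orbit configuration spaces amounts to a continuous choice
of a point outside the orbits of a configuration. -/
theorem admitsCrossSection_orbitConfProj_iff {n : ℕ} :
    AdmitsCrossSection (orbitConfProj G X n) ↔
      ∃ q : orbitConf G X n → X, Continuous q ∧
        ∀ (p : orbitConf G X n) (i : Fin n), q p ∉ MulAction.orbit G (p.1 i) := by
  constructor
  · rintro ⟨s, hs⟩
    refine ⟨fun p => (s p).1 (Fin.last n),
      (continuous_apply _).comp (continuous_subtype_val.comp s.continuous), fun p i => ?_⟩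
    have h := congrFun (congrArg Subtype.val (DFunLike.congr_fun hs p)) i
    change (s p).1 i.castSucc = p.1 i at h
    rw [← h]
    exact (s p).2 _ _ (Fin.castSucc_lt_last i).ne'
  · rintro ⟨q, hq, hqp⟩
    refine ⟨⟨fun p => ⟨Fin.snoc p.1 (q p), fun i j hij => ?_⟩,
      Continuous.subtype_mk (continuous_pi fun i => ?_) _⟩, ?_⟩
    · induction i using Fin.lastCases with
      | last =>
        induction j using Fin.lastCases with
        | last => exact absurd rfl hij
        | cast j => simpa using hqp p j
      | cast i =>
        induction j using Fin.lastCases with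
        | last =>
          rw [Fin.snoc_castSucc, Fin.snoc_last, MulAction.mem_orbit_symm]
          exact hqp p i
        | cast j =>
          simpa using p.2 i j fun h => hij (congrArg _ h)
    · induction i using Fin.lastCases with
      | last => simpa using hq
      | cast i => simpa [Function.comp_def] using (continuous_apply i).comp continuous_subtype_val
    · ext p i
      simp [orbitConfProj]

end OrbitConf

section SphereAction

variable {G : Type*} [Group G] [MulAction G TwoSphere]

/-- If two further points, distinct from each other and from one point of the configuration, depend
continuously on the configuration, then the projection of orbit configuration spaces of a free
action on the two-sphere admits a cross-section. -/
theorem admitsCrossSection_orbitConfProj_of_three_points [Finite G]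
    [ContinuousConstSMul G TwoSphere]
    (hfree : ∀ (g : G) (x : TwoSphere), g • x = x → g = 1) {n : ℕ} (i₀ : Fin n)
    {b c : orbitConf G TwoSphere n → TwoSphere} (hb : Continuous b) (hc : Continuous c)
    (hba : ∀ p, b p ≠ p.1 i₀) (hca : ∀ p, c p ≠ p.1 i₀) (hbc : ∀ p, b p ≠ c p) :
    AdmitsCrossSection (orbitConfProj G TwoSphere n) := by
  have hcont : ∀ i : Fin n, Continuous fun p : orbitConf G TwoSphere n => p.1 i :=
    fun i => (continuous_apply i).comp continuous_subtype_val
  -- The pair `(1, i₀)` is left out because it gives `p i₀` itself; freeness separates the other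
  -- translates of `p i₀` from it.
  obtain ⟨q, hqc, hqa, hqF⟩ := TwoSphere.exists_continuous_avoiding (hcont i₀) hb hc hba hca hbc
    (ι := {k : G × Fin n // k ≠ (1, i₀)}) (F := fun k p => k.1.1 • p.1 k.1.2)
    (fun k => (hcont k.1.2).const_smul k.1.1) (fun k p h => by
      obtain ⟨⟨g, i⟩, hk⟩ := k
      rcases eq_or_ne i i₀ with rfl | hi
      · exact hk (by rw [hfree g _ h])
      · exact p.2 i₀ i hi.symm ⟨g, h⟩)
  refine admitsCrossSection_orbitConfProj_iff.2 ⟨q, hqc, fun p i => ?_⟩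
  rintro ⟨g, hg⟩
  by_cases hk : (g, i) = (1, i₀)
  · obtain ⟨rfl, rfl⟩ := Prod.mk.inj hk
    exact hqa p (by simpa using hg.symm)
  · exact hqF ⟨(g, i), hk⟩ p hg.symm

end SphereAction

theorem mainTheorem5 (G : Type*) [Group G] [Finite G]
    [MulAction G TwoSphere] [ContinuousConstSMul G TwoSphere]
    (hfree : ∀ (g : G) (x : TwoSphere), g • x = x → g = 1) :
    (Subsingleton G → ∀ n : ℕ,
      (AdmitsCrossSection (orbitConfProj G TwoSphere n) ↔ n ≠ 2)) ∧
    (Nontrivial G → ∀ n : ℕ, 1 ≤ n →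
      (AdmitsCrossSection (orbitConfProj G TwoSphere n) ↔ 2 ≤ n)) := by
  have hcont : ∀ {n : ℕ} (i : Fin n), Continuous fun p : orbitConf G TwoSphere n => p.1 i :=
    fun i => (continuous_apply i).comp continuous_subtype_val
  have hnorm_neg : ∀ x : TwoSphere, -x ≠ x := fun x => (ne_neg_of_mem_unit_sphere ℝ x).symm
  refine ⟨fun _ n => ⟨?_, fun hn => ?_⟩, fun _ n hn1 => ⟨fun h => ?_, fun hn => ?_⟩⟩
  · rintro h rfl
    obtain ⟨q, hqc, hq⟩ := admitsCrossSection_orbitConfProj_iff.1 h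
    have horb : ∀ x y : TwoSphere, x ≠ y → x ∉ MulAction.orbit G y := by
      rintro x y hxy ⟨g, hg⟩
      exact hxy (by simpa [Subsingleton.elim g 1] using hg.symm)
    let P : TwoSphere → orbitConf G TwoSphere 2 := fun x => ⟨![x, -x], fun i j hij => by
      apply horb
      fin_cases i <;> fin_cases j <;> first | exact absurd rfl hij | skip
      · exact (hnorm_neg x).symm
      · exact hnorm_neg x⟩
    have hP : Continuous P := Continuous.subtype_mk (continuous_pi fun i => by
      fin_cases i
      · exact continuous_id
      · exact continuous_neg) _
    obtain ⟨x, hx⟩ := TwoSphere.exists_coincidence (hqc.comp hP) continuous_neg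
    rcases hx with hx | hx | hx
    · exact hq (P x) 0 ⟨1, (one_smul G x).trans hx.symm⟩
    · exact hnorm_neg x hx
    · exact hq (P x) 1 ⟨1, (one_smul G (-x)).trans hx.symm⟩
  · match n, hn with
    | 0, _ =>
      obtain ⟨x⟩ : Nonempty TwoSphere := ⟨⟨EuclideanSpace.single 0 1, by simp⟩⟩
      exact admitsCrossSection_orbitConfProj_iff.2 ⟨fun _ => x, continuous_const, fun _ i => i.elim0⟩
    | 1, _ =>
      refine admitsCrossSection_orbitConfProj_iff.2 ⟨fun p => -p.1 0, (hcont 0).neg, ?_⟩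
      rintro p i ⟨g, hg⟩
      obtain rfl : i = 0 := Subsingleton.elim _ _
      exact hnorm_neg (p.1 0) (by simpa [Subsingleton.elim g 1] using hg.symm)
    | n + 3, _ =>
      exact admitsCrossSection_orbitConfProj_of_three_points hfree 0 (hcont 1)
        (hcont ⟨2, by omega⟩)
        (fun p => orbitConf.apply_ne p (by simp))
        (fun p => orbitConf.apply_ne p (by simp [Fin.ext_iff]))
        (fun p => orbitConf.apply_ne p (by simp [Fin.ext_iff]))
  · by_contra hlt
    obtain rfl : n = 1 := by omega
    obtain ⟨q, hqc, hq⟩ := admitsCrossSection_orbitConfProj_iff.1 h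
    obtain ⟨g, hg⟩ := exists_ne (1 : G)
    let P : TwoSphere → orbitConf G TwoSphere 1 := fun x =>
      ⟨fun _ => x, fun i j hij => absurd (Subsingleton.elim i j) hij⟩
    have hP : Continuous P := Continuous.subtype_mk (continuous_pi fun i => continuous_id) _
    obtain ⟨x, hx⟩ := TwoSphere.exists_coincidence (hqc.comp hP) (continuous_const_smul g)
    rcases hx with hx | hx | hx
    · exact hq (P x) 0 ⟨1, (one_smul G x).trans hx.symm⟩
    · exact hg (hfree g x hx)
    · exact hq (P x) 0 ⟨g, hx.symm⟩
  · obtain ⟨k, rfl⟩ := Nat.exists_eq_add_of_le' hn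
    obtain ⟨g, hg⟩ := exists_ne (1 : G)
    exact admitsCrossSection_orbitConfProj_of_three_points hfree 0 (hcont 1)
      ((hcont 0).const_smul g) (fun p => orbitConf.apply_ne p (by simp))
      (fun p h => hg (hfree g _ h))
      (fun p h => p.2 1 0 (by simp) ⟨g, h.symm⟩)
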